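/- Moser variables are special Darboux–Nijenhuis variables for the open Toda lattice. Let $n\ge 1$ and let $M=\mathbb R^{2n}$ with coordinates $(q_1,\dots,q_n,p_1,\dots,p_n)$. A bivector field $\Pi=(\Pi^{ab})$ on $M$ defines the bracket $\{f,g\}_\Pi=\sum_{a,b}\Pi^{ab}\,\partial_af\,\partial_bg$. Let $\{\cdot,\cdot\}$ and $\{\cdot,\cdot\}'$ be the brackets of $$P=\sum_{i=1}^n\frac{\partial}{\partial q_i}\wedge\frac{\partial}{\partial p_i},\qquad P'=\sum_{i=1}^{n-1}e^{q_i-q_{i+1}}\frac{\partial}{\partial p_{i+1}}\wedge\frac{\partial}{\partial p_i}+\sum_{i=1}^n p_i\frac{\partial}{\partial q_i}\wedge\frac{\partial}{\partial p_i}+\sum_{i<j}\frac{\partial}{\partial q_j}\wedge\frac{\partial}{\partial q_i},$$ where $\partial_a\wedge\partial_b$ is normalized so that $\{z_a,z_b\}=1$; in particular $\{q_i,p_j\}=\delta_{ij}$. Let $\omega=P^{-1}$, $N=P'P^{-1}$ (the recursion operator) and $N^*=P^{-1}P'$. Let $L$ be the symmetric tridiagonal $n\times n$ matrix with $L_{jj}=p_j$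 and $L_{j,j+1}=L_{j+1,j}=e^{(q_j-q_{j+1})/2}$, let $\vec\alpha=(0,\dots,0,e^{q_n/2})$, and let $\mathcal X(\lambda)=\bigl((L-\lambda I)^{-1}\vec\alpha,\vec\alpha\bigr)$ be the Weyl function. Put $A(\lambda)=\det(\lambda I-L)$ and $B(\lambda)=-\bigl(\operatorname{adj}(\lambda I-L)\vec\alpha,\vec\alpha\bigr)$. Then the following hold. 1. At every point of $M$ the polynomial $A$ has $n$ distinct real roots $\lambda_1<\dots<\lambda_n$, so that $A(\lambda)=\prod_i(\lambda-\lambda_i)$, and $A$ is the minimal characteristic polynomial $\Delta_N$ of $N$, that is, the monic polynomial with $\Delta_N(\lambda)^2=\det(\lambda I-N)$. 2. $\mathcal X(\lambda)=B(\lambda)/A(\lambda)$ whenever $A(\lambda)\neq0$; $B$ has degree $n-1$ and leading coefficient $-e^{q_n}$; and $B(\lambda_i)\ne0$ for all $i$. Put $\mu_i=\ln|B(\lambda_i)|$. 3. The functions $(x_i,y_i)=(\mu_i,\lambda_i)$ are Darboux–Nijenhuis coordinates: $z\mapsto(\mu_1,\dots,\mu_n,\lambda_1,\dots,\lambda_n)$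 is a $C^\infty$ local diffeomorphism $M\to\mathbb R^{2n}$ (so that $(\mu,\lambda)$ are local coordinates near each point), $\omega=\sum_i d\lambda_i\wedge d\mu_i$, and $$N=\sum_{i=1}^n\lambda_i\left(\frac{\partial}{\partial\mu_i}\otimes d\mu_i+\frac{\partial}{\partial\lambda_i}\otimes d\lambda_i\right).$$ 4. $\{\mu_i,\lambda_j\}=\delta_{ij}$, $\{\mu_i,\lambda_j\}'=\lambda_i\delta_{ij}$, and $\{\lambda_i,\lambda_j\}=\{\mu_i,\mu_j\}=\{\lambda_i,\lambda_j\}'=\{\mu_i,\mu_j\}'=0$ for all $i,j$. 5. $N^*d\lambda_i=\lambda_i\,d\lambda_i$ and $N^*d\mu_i=\lambda_i\,d\mu_i$ for all $i$. -/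

import Mathlib

open Matrix Polynomial

noncomputable section

namespace Toda

/-- Coordinate labels of the phase space `ℝ²ⁿ`: `inl i` is `q i`, `inr i` is `p i`. -/
abbrev Coord (n : ℕ) : Type := Fin n ⊕ Fin n

/-- The phase space `M = ℝ²ⁿ` of the `n`-particle open Toda lattice. -/
abbrev Phase (n : ℕ) : Type := Coord n → ℝ

/-- The position `q i` of the `i`-th particle. -/
def q {n : ℕ} (z : Phase n) (i : Fin n) : ℝ := z (Sum.inl i)

/-- The momentum `p i` of the `i`-th particle. -/
def p {n : ℕ} (z : Phase n) (i : Fin n) : ℝ := z (Sum.inr i)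

/-! ### Bivectors, brackets, recursion operator

A bivector field is given by the matrix of its components, so that `∂_a ∧ ∂_b` has entry `1` at
`(a, b)` and entry `-1` at `(b, a)`. -/

/-- The differential `df` at `z`, as the row of its components `∂f / ∂z_a`. -/
def d {n : ℕ} (f : Phase n → ℝ) (z : Phase n) : Coord n → ℝ :=
  fun a => fderiv ℝ f z (Pi.single a 1)

/-- The bracket `⟨df, Π dg⟩ = ∑ Π^{ab} ∂_a f ∂_b g` at `z` defined by a bivector field `Π`. -/
def bracket {n : ℕ} (biv : Phase n → Matrix (Coord n) (Coord n) ℝ) (f g : Phase n → ℝ)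
    (z : Phase n) : ℝ :=
  d f z ⬝ᵥ (biv z *ᵥ d g z)

/-- The canonical bivector `P = ∑ ∂_{q_i} ∧ ∂_{p_i}`, that is `{q_i, p_j} = δ_ij`. -/
def P {n : ℕ} (_z : Phase n) : Matrix (Coord n) (Coord n) ℝ :=
  fromBlocks 0 1 (-1) 0

/-- The second bivector
`P' = ∑_{i<n} e^{q_i - q_{i+1}} ∂_{p_{i+1}} ∧ ∂_{p_i} + ∑_i p_i ∂_{q_i} ∧ ∂_{p_i}
  + ∑_{i<j} ∂_{q_j} ∧ ∂_{q_i}`. -/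
def P' {n : ℕ} (z : Phase n) : Matrix (Coord n) (Coord n) ℝ :=
  fromBlocks
    (Matrix.of fun i j : Fin n => if j < i then 1 else if i < j then -1 else 0)
    (diagonal (p z))
    (-diagonal (p z))
    (Matrix.of fun i j : Fin n =>
      if (i : ℕ) = j + 1 then Real.exp (q z j - q z i)
      else if (j : ℕ) = i + 1 then -Real.exp (q z i - q z j) else 0)

/-- The recursion operator `N = P' P⁻¹`, acting on tangent vectors. -/
def N {n : ℕ} (z : Phase n) : Matrix (Coord n) (Coord n) ℝ := P' z * (P z)⁻¹

/-- The dual operator `N^* = P⁻¹ P'`, acting on covectors. -/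
def Nstar {n : ℕ} (z : Phase n) : Matrix (Coord n) (Coord n) ℝ := (P z)⁻¹ * P' z

/-- `Δ` is the minimal characteristic polynomial `(det (N - λ I))^{1/2}` of `M`: the monic square
root of the characteristic polynomial. -/
def IsMinimalCharpoly {n : ℕ} (M : Matrix (Coord n) (Coord n) ℝ) (Δ : ℝ[X]) : Prop :=
  Δ.Monic ∧ Δ ^ 2 = M.charpoly

/-! ### Darboux–Nijenhuis coordinates -/

/-- The map `z ↦ (x₁, …, xₙ, y₁, …, yₙ)`. -/
def coordMap {n : ℕ} (x y : Fin n → Phase n → ℝ) (z : Phase n) : Phase n :=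
  Sum.elim (fun i => x i z) (fun i => y i z)

/-- The Jacobian matrix of `z ↦ (x, y)`; its rows are the differentials of the `x i` and `y i`. -/
def jacobian {n : ℕ} (x y : Fin n → Phase n → ℝ) (z : Phase n) : Matrix (Coord n) (Coord n) ℝ :=
  Matrix.of (Sum.elim (fun i => d (x i) z) (fun i => d (y i) z))

/-- `(x, y)` are Darboux–Nijenhuis coordinates near each point of `M`, the eigenvalue of the
recursion operator that belongs to the pair `(x i, y i)` being `ν i`. -/
structure IsDarbouxNijenhuis {n : ℕ} (x y ν : Fin n → Phase n → ℝ) : Prop where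
  /-- `(x, y)` are smooth local coordinates near each point. -/
  coordinates : IsLocalDiffeomorph (modelWithCornersSelf ℝ (Phase n))
    (modelWithCornersSelf ℝ (Phase n)) ((⊤ : ℕ∞) : WithTop ℕ∞) (coordMap x y)
  /-- They are canonical: `ω = P⁻¹ = ∑ dy_i ∧ dx_i`. -/
  canonical : ∀ z, (P z)⁻¹ =
    ∑ i, (vecMulVec (d (y i) z) (d (x i) z) - vecMulVec (d (x i) z) (d (y i) z))
  /-- In these coordinates `N = ∑ ν_i (∂/∂x_i ⊗ dx_i + ∂/∂y_i ⊗ dy_i)`. -/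
  diagonalizes : ∀ z, jacobian x y z * N z * (jacobian x y z)⁻¹ =
    diagonal (Sum.elim (fun i => ν i z) (fun i => ν i z))

/-! ### Lax matrix, Weyl function, Moser variables -/

/-- The Lax matrix: the symmetric tridiagonal matrix with `L_{jj} = p_j` and
`L_{j,j+1} = L_{j+1,j} = e^{(q_j - q_{j+1})/2}`. -/
def lax {n : ℕ} (z : Phase n) : Matrix (Fin n) (Fin n) ℝ :=
  Matrix.of fun j k =>
    if j = k then p z j
    else if (k : ℕ) = j + 1 then Real.exp ((q z j - q z k) / 2)
    else if (j : ℕ) = k + 1 then Real.exp ((q z k - q z j) / 2)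
    else 0

/-- The normalization vector `α = (0, …, 0, e^{q_n / 2})`. -/
def alpha {n : ℕ} (z : Phase n) : Fin n → ℝ :=
  fun j => if (j : ℕ) + 1 = n then Real.exp (q z j / 2) else 0

/-- The Weyl function `X(t) = (R(t) α, α)`, with `R(t) = (L - t I)⁻¹`. -/
def weyl {n : ℕ} (z : Phase n) (t : ℝ) : ℝ :=
  ((lax z - t • (1 : Matrix (Fin n) (Fin n) ℝ))⁻¹ *ᵥ alpha z) ⬝ᵥ alpha z

/-- The monic denominator `A(t) = det (t I - L)` of the Weyl function. -/
def A {n : ℕ} (z : Phase n) : ℝ[X] := (lax z).charpoly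

/-- The numerator `B(t) = -(adj(t I - L) α, α)` of the Weyl function over the monic
denominator `A(t)`. -/
def B {n : ℕ} (z : Phase n) : ℝ[X] :=
  -(((charmatrix (lax z)).adjugate *ᵥ fun j => C (alpha z j)) ⬝ᵥ fun j => C (alpha z j))

/-- `λ_i`: the `i`-th root of `A` in increasing order, with multiplicities. -/
def lam {n : ℕ} (i : Fin n) (z : Phase n) : ℝ :=
  ((A z).roots.sort (· ≤ ·)).getD i 0

/-- `μ_i = ln |B(λ_i)|` (`Real.log` is the logarithm of the absolute value). -/
def mu {n : ℕ} (i : Fin n) (z : Phase n) : ℝ :=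
  Real.log ((B z).eval (lam i z))

end Toda

end

open Matrix Polynomial

noncomputable section

namespace Toda

/-! Everything reduces to one eigenvalue relation, `P' ξ = t P ξ`, for the covectors `ξ = dλ_i` and
`ξ = dμ_i` with `t = λ_i`. For symmetric `S`, the vector `(P' - t P) tr (S dL)` depends only on the
diagonal and the entries next to it of `(t I - L) S` (`P'_covec_inl`, `P'_covec_inr`).

By Jacobi's formula `dλ_i` is proportional to `tr (S dL)` with `S = adj (λ_i I - L)`, and `(λ_i I -
L) S = 0`. For `μ_i`, `B(t)` is `-e^{q_n}` times the minor `D` of `t I - L` without the last row and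
column, so its differential at fixed `t` is a multiple of `D dq_n - tr (S dL)`, with `S` the
adjugate of that minor; at a root of `A` this is again an eigenvector (`P'_covec_borderedAdj`).
Adding a multiple of `dλ_i` yields `dμ_i`.

The tridiagonal form makes the spectrum simple and keeps `D` nonzero on it, so the variables are
smooth and eigenvectors with different indices are in involution for both brackets. Only `{μ_i, λ_i}
= 1` needs another argument: `∑ λ_k = tr L = ∑ p_k` generates the simultaneous translation of all
particles, along which `L` is fixed and `B` is rescaled, so each `μ_i` grows at unit rate
(`bracket_mu_lam`). The brackets make the Jacobian symplectic, hence invertible, and the eigenvector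
relations say that it diagonalizes `N`. -/

/-- The strictly upper triangular part of the Lax matrix. -/
def upper {n : ℕ} (z : Phase n) : Matrix (Fin n) (Fin n) ℝ :=
  Matrix.of fun j k => if (k : ℕ) = j + 1 then Real.exp ((q z j - q z k) / 2) else 0

/-- The covector `tr (S dL)` for a symmetric matrix `S`. -/
def covec {n : ℕ} (z : Phase n) (S : Matrix (Fin n) (Fin n) ℝ) : Coord n → ℝ :=
  Sum.elim (fun j => ∑ k, (upper z j k * S j k - upper z k j * S k j)) (fun j => S j j)

/-- The matrix `t I - L`. -/
def shifted {n : ℕ} (z : Phase n) (t : ℝ) : Matrix (Fin n) (Fin n) ℝ :=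
  scalar (Fin n) t - lax z

variable {n : ℕ}

/-! ### Entries of the Lax matrix -/

theorem upper_of_ne (z : Phase n) {j k : Fin n} (h : (k : ℕ) ≠ j + 1) : upper z j k = 0 := by
  simp [upper, h]

theorem upper_self (z : Phase n) (j : Fin n) : upper z j j = 0 :=
  upper_of_ne z (by omega)

theorem upper_sq (z : Phase n) (j k : Fin n) :
    upper z j k ^ 2 = if (k : ℕ) = j + 1 then Real.exp (q z j - q z k) else 0 := by
  unfold upper
  simp only [of_apply]
  split_ifs
  · rw [← Real.exp_nat_mul]; congr 1; push_cast; ring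
  · simp

theorem upper_mul_upper (z : Phase n) (i j k : Fin n) :
    upper z i j * upper z i k = if j = k then upper z i j ^ 2 else 0 := by
  split_ifs with h
  · rw [h, sq]
  · by_cases hj : (j : ℕ) = i + 1
    · rw [upper_of_ne z (j := i) (k := k) (fun hk => h (Fin.ext (hj.trans hk.symm))), mul_zero]
    · rw [upper_of_ne z hj, zero_mul]

theorem upper_mul_upper' (z : Phase n) (i j k : Fin n) :
    upper z j i * upper z k i = if j = k then upper z j i ^ 2 else 0 := by
  split_ifs with h
  · rw [h, sq]
  · by_cases hj : (i : ℕ) = j + 1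
    · rw [upper_of_ne z (j := k) (k := i) (fun hk => h (Fin.ext (by omega))), mul_zero]
    · rw [upper_of_ne z hj, zero_mul]

theorem lax_eq (z : Phase n) : lax z = diagonal (p z) + upper z + (upper z)ᵀ := by
  ext j k
  simp only [lax, upper, of_apply, Matrix.add_apply, transpose_apply, diagonal_apply]
  split_ifs with h1 h2 h3 <;> first | (exfalso; subst h1; omega) | (exfalso; omega) | simp

theorem lax_isSymm (z : Phase n) : (lax z).IsSymm := by
  rw [lax_eq]
  unfold Matrix.IsSymm
  simp only [transpose_add, diagonal_transpose, transpose_transpose]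
  abel

theorem shifted_isSymm (z : Phase n) (t : ℝ) : (shifted z t).IsSymm := by
  unfold shifted Matrix.IsSymm
  rw [transpose_sub, (lax_isSymm z).eq, scalar_apply, diagonal_transpose]

/-! ### The two bivectors applied to trace covectors -/

theorem P'_lower_right (z : Phase n) (i j : Fin n) :
    P' z (Sum.inr i) (Sum.inr j) = upper z j i ^ 2 - upper z i j ^ 2 := by
  simp only [P', fromBlocks_apply₂₂, of_apply, upper_sq]
  split_ifs <;> first | (exfalso; omega) | simp

theorem shifted_mul_apply (z : Phase n) (t : ℝ) (S : Matrix (Fin n) (Fin n) ℝ) (i j : Fin n) :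
    (shifted z t * S) i j =
      (t - p z i) * S i j - ∑ k, (upper z i k + upper z k i) * S k j := by
  rw [shifted, lax_eq, sub_mul, add_mul, add_mul]
  simp only [Matrix.sub_apply, Matrix.add_apply, scalar_apply, diagonal_mul, mul_apply (M := upper z),
    mul_apply (M := (upper z)ᵀ), transpose_apply, add_mul, Finset.sum_add_distrib]
  ring

theorem shifted_mulVec_apply (z : Phase n) (t : ℝ) (x : Fin n → ℝ) (i : Fin n) :
    (shifted z t *ᵥ x) i = (t - p z i) * x i - ∑ k, (upper z i k + upper z k i) * x k := by
  have := shifted_mul_apply z t (replicateCol (Fin n) x) i i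
  simpa [mul_apply, mulVec, dotProduct] using this

/-- Each bond `(j, j+1)` enters the position components at `j` and `j+1` with opposite signs.
Weighted by the sign of `i - j`, the two contributions cancel unless the bond touches `i`. -/
theorem sum_sign_mul_covec (z : Phase n) (S : Matrix (Fin n) (Fin n) ℝ) (hS : S.IsSymm)
    (i : Fin n) :
    ∑ j : Fin n, (if j < i then (1 : ℝ) else if i < j then -1 else 0) *
        ∑ k, (upper z j k * S j k - upper z k j * S k j) =
      ∑ k, (upper z i k + upper z k i) * S k i := by
  have h1 : ∀ j k : Fin n,
      (if j < i then (1 : ℝ) else if i < j then -1 else 0) * (upper z j k * S j k) -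
      (if k < i then (1 : ℝ) else if i < k then -1 else 0) * (upper z j k * S j k) =
      (if i = j then upper z i k * S i k else 0) + (if i = k then upper z j i * S j i else 0) := by
    intro j k
    by_cases h : (k : ℕ) = j + 1
    · simp only [Fin.lt_def, Fin.ext_iff]
      rcases lt_trichotomy (i : ℕ) j with hij | hij | hij
      · rw [if_neg (by omega), if_pos (by omega), if_neg (by omega), if_pos (by omega),
          if_neg (by omega), if_neg (by omega)]; ring
      · obtain rfl : i = j := Fin.ext hij
        rw [if_neg (by omega), if_neg (by omega), if_neg (by omega), if_pos (by omega),
          if_pos rfl, if_neg (by omega)]; ring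
      · by_cases hk : (i : ℕ) = k
        · obtain rfl : i = k := Fin.ext hk
          rw [if_pos (by omega), if_neg (by omega), if_neg (by omega), if_neg (by omega),
            if_pos rfl]; ring
        · rw [if_pos (by omega), if_pos (by omega), if_neg (by omega), if_neg hk]; ring
    · rw [upper_of_ne z h]
      have e1 : (if i = j then upper z i k * S i k else 0) = 0 := by
        split_ifs with e
        · rw [e, upper_of_ne z h, zero_mul]
        · rfl
      have e2 : (if i = k then upper z j i * S j i else 0) = 0 := by
        split_ifs with e
        · rw [e, upper_of_ne z h, zero_mul]
        · rfl
      rw [e1, e2]; ring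
  have h2 := Finset.sum_congr rfl fun j (_ : j ∈ Finset.univ) =>
    Finset.sum_congr rfl fun k (_ : k ∈ Finset.univ) => h1 j k
  simp only [Finset.sum_add_distrib, Finset.sum_sub_distrib] at h2
  have hcomm := Finset.sum_comm (s := Finset.univ) (t := Finset.univ) (f := fun j k : Fin n =>
    (if k < i then (1 : ℝ) else if i < k then -1 else 0) * (upper z j k * S j k))
  rw [hcomm] at h2
  simp only [Finset.mul_sum, mul_sub, Finset.sum_sub_distrib, add_mul, Finset.sum_add_distrib]
  rw [h2]
  congr 1
  · rw [Finset.sum_comm]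
    refine Finset.sum_congr rfl fun k _ => ?_
    rw [Finset.sum_ite_eq, if_pos (Finset.mem_univ _), hS.apply]
  · exact Finset.sum_congr rfl fun k _ => by rw [Finset.sum_ite_eq, if_pos (Finset.mem_univ _)]

theorem P_mulVec (z : Phase n) (ξ : Coord n → ℝ) :
    P z *ᵥ ξ = Sum.elim (fun i => ξ (Sum.inr i)) (fun i => -ξ (Sum.inl i)) := by
  ext (i | i)
  · simp [P, mulVec, dotProduct, Fintype.sum_sum_type, one_apply]
  · simp [P, mulVec, dotProduct, Fintype.sum_sum_type, one_apply]

theorem P'_mulVec_inl (z : Phase n) (ξ : Coord n → ℝ) (i : Fin n) :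
    (P' z *ᵥ ξ) (Sum.inl i) =
      ∑ j : Fin n, (if j < i then (1 : ℝ) else if i < j then -1 else 0) * ξ (Sum.inl j)
        + p z i * ξ (Sum.inr i) := by
  simp [P', mulVec, dotProduct, Fintype.sum_sum_type, diagonal_apply]

theorem P'_mulVec_inr (z : Phase n) (ξ : Coord n → ℝ) (i : Fin n) :
    (P' z *ᵥ ξ) (Sum.inr i) = -(p z i * ξ (Sum.inl i)) +
      ∑ j, (upper z j i ^ 2 - upper z i j ^ 2) * ξ (Sum.inr j) := by
  simp only [← P'_lower_right]
  simp [P', mulVec, dotProduct, Fintype.sum_sum_type, diagonal_apply]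

theorem P'_covec_inl (z : Phase n) (t : ℝ) (S : Matrix (Fin n) (Fin n) ℝ) (hS : S.IsSymm)
    (i : Fin n) :
    (P' z *ᵥ covec z S) (Sum.inl i) - t * (P z *ᵥ covec z S) (Sum.inl i) =
      -(shifted z t * S) i i := by
  rw [P'_mulVec_inl, P_mulVec, shifted_mul_apply]
  simp only [covec, Sum.elim_inl, Sum.elim_inr]
  rw [sum_sign_mul_covec z S hS]
  ring

/-- The exponentials in `P'` are squares of off-diagonal Lax entries. They have to match the
products of two such entries that arise on expanding the right-hand side. -/
theorem P'_covec_inr (z : Phase n) (t : ℝ) (S : Matrix (Fin n) (Fin n) ℝ) (hS : S.IsSymm)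
    (i : Fin n) :
    (P' z *ᵥ covec z S) (Sum.inr i) - t * (P z *ᵥ covec z S) (Sum.inr i) =
      ∑ k, (upper z i k - upper z k i) * (shifted z t * S) i k := by
  rw [P'_mulVec_inr, P_mulVec]
  simp only [shifted_mul_apply, covec, Sum.elim_inl, Sum.elim_inr]
  -- The coefficient is antisymmetric in `k` and `m`, while `S` is symmetric.
  have hcross : ∑ k, ∑ m, (upper z i k * upper z m i - upper z k i * upper z i m) * S m k = 0 := by
    have h : ∑ k, ∑ m, (upper z i k * upper z m i - upper z k i * upper z i m) * S m k =
        -∑ k, ∑ m, (upper z i k * upper z m i - upper z k i * upper z i m) * S m k := by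
      conv_lhs => rw [Finset.sum_comm]
      rw [← Finset.sum_neg_distrib]
      refine Finset.sum_congr rfl fun k _ => ?_
      rw [← Finset.sum_neg_distrib]
      refine Finset.sum_congr rfl fun m _ => ?_
      rw [hS.apply k m]; ring
    linarith
  -- Every row and every column of `upper z` has at most one nonzero entry, so only `m = k`
  -- survives.
  have hdiag : ∑ k, ∑ m, (upper z i k * upper z i m - upper z k i * upper z m i) * S m k =
      ∑ k, (upper z i k ^ 2 - upper z k i ^ 2) * S k k := by
    refine Finset.sum_congr rfl fun k _ => ?_
    simp only [upper_mul_upper, upper_mul_upper']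
    rw [Finset.sum_eq_single k]
    · simp
    · intro m _ hm
      simp [hm.symm]
    · simp
  have hexp : ∑ k, (upper z i k - upper z k i) *
        ∑ m, (upper z i m + upper z m i) * S m k =
      ∑ k, (upper z i k ^ 2 - upper z k i ^ 2) * S k k := by
    rw [← hdiag, ← add_zero (∑ k, ∑ m, _), ← hcross, ← Finset.sum_add_distrib]
    refine Finset.sum_congr rfl fun k _ => ?_
    rw [Finset.mul_sum, ← Finset.sum_add_distrib]
    exact Finset.sum_congr rfl fun m _ => by ring
  simp only [mul_sub, Finset.sum_sub_distrib, hexp]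
  have h3 : ∑ k, (upper z i k - upper z k i) * ((t - p z i) * S i k) =
      (t - p z i) * (∑ k, upper z i k * S i k - ∑ k, upper z k i * S k i) := by
    rw [← Finset.sum_sub_distrib, Finset.mul_sum]
    exact Finset.sum_congr rfl fun k _ => by rw [hS.apply k i]; ring
  rw [h3]
  have h4 : ∑ j, (upper z j i ^ 2 - upper z i j ^ 2) * S j j =
      -∑ k, (upper z i k ^ 2 - upper z k i ^ 2) * S k k := by
    rw [← Finset.sum_neg_distrib]
    exact Finset.sum_congr rfl fun k _ => by ring
  rw [h4]
  ring

/-- The spectral covector `tr (S dL)` is an eigenvector of the recursion relation. -/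
theorem P'_covec_of_shifted_mul_eq_zero (z : Phase n) (t : ℝ) (S : Matrix (Fin n) (Fin n) ℝ)
    (hS : S.IsSymm) (h : shifted z t * S = 0) :
    P' z *ᵥ covec z S = t • (P z *ᵥ covec z S) := by
  ext (i | i)
  · have := P'_covec_inl z t S hS i
    rw [h, Matrix.zero_apply, neg_zero, sub_eq_zero] at this
    simpa using this
  · have := P'_covec_inr z t S hS i
    rw [h, sub_eq_iff_eq_add] at this
    simpa using this

/-! ### Bordered matrices -/

/-- The matrix `M` with its row and column `l` replaced by those of the identity. -/
def bordered (M : Matrix (Fin n) (Fin n) ℝ) (l : Fin n) : Matrix (Fin n) (Fin n) ℝ :=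
  (M.updateRow l (Pi.single l 1)).updateCol l (Pi.single l 1)

theorem bordered_apply (M : Matrix (Fin n) (Fin n) ℝ) (l i j : Fin n) :
    bordered M l i j =
      if j = l then (if i = l then 1 else 0) else if i = l then 0 else M i j := by
  simp only [bordered, updateCol_apply, updateRow_apply, Pi.single_apply]
  split_ifs <;> rfl

theorem bordered_isSymm {M : Matrix (Fin n) (Fin n) ℝ} (hM : M.IsSymm) (l : Fin n) :
    (bordered M l).IsSymm := by
  refine IsSymm.ext fun i j => ?_
  simp only [bordered_apply, hM.apply]
  split_ifs <;> rfl

theorem adjugate_apply_updateCol (U : Matrix (Fin n) (Fin n) ℝ) (l : Fin n) :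
    (U.updateCol l (Pi.single l 1)).det = U.adjugate l l := by
  rw [← det_transpose, ← updateRow_transpose, ← adjugate_apply, ← adjugate_transpose,
    transpose_apply]

/-- Writes the minor as the determinant of a matrix of full size that is symmetric whenever `M` is,
so that Jacobi's formula applies to it without reindexing. -/
theorem det_bordered (M : Matrix (Fin n) (Fin n) ℝ) (l : Fin n) :
    (bordered M l).det = M.adjugate l l := by
  rw [adjugate_apply, bordered, adjugate_apply_updateCol]
  set U := M.updateRow l (Pi.single l 1) with hU
  have h : (U * U.adjugate) l l = U.det := by rw [mul_adjugate]; simp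
  rw [← h, mul_apply, Finset.sum_eq_single l]
  · simp [hU]
  · intro b _ hb
    simp [hU, hb]
  · simp

/-- The adjugate of the bordered matrix with its entry at `(l, l)` removed. -/
def borderedAdj (M : Matrix (Fin n) (Fin n) ℝ) (l : Fin n) : Matrix (Fin n) (Fin n) ℝ :=
  (bordered M l).adjugate - Matrix.single l l (M.adjugate l l)

theorem borderedAdj_isSymm {M : Matrix (Fin n) (Fin n) ℝ} (hM : M.IsSymm) (l : Fin n) :
    (borderedAdj M l).IsSymm := by
  unfold borderedAdj Matrix.IsSymm
  rw [transpose_sub, ((bordered_isSymm hM l).adjugate).eq, transpose_single]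

theorem bordered_adjugate_row (M : Matrix (Fin n) (Fin n) ℝ) (l j : Fin n) :
    (bordered M l).adjugate l j = if l = j then M.adjugate l l else 0 := by
  have h : (bordered M l * (bordered M l).adjugate) l j =
      if l = j then M.adjugate l l else 0 := by
    rw [mul_adjugate, det_bordered]; simp [one_apply]
  rw [← h, mul_apply, Finset.sum_eq_single l]
  · simp [bordered_apply]
  · intro b _ hb
    simp [bordered_apply, hb]
  · simp

/-- Dropping the `(l, l)` entry clears row `l` (and, for symmetric `M`, column `l`), so `tr (S dL)`
involves only the block seen by the minor. -/
theorem borderedAdj_row (M : Matrix (Fin n) (Fin n) ℝ) (l j : Fin n) :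
    borderedAdj M l l j = 0 := by
  rw [borderedAdj, Matrix.sub_apply, bordered_adjugate_row, single_apply]
  simp

theorem borderedAdj_col {M : Matrix (Fin n) (Fin n) ℝ} (hM : M.IsSymm) (l j : Fin n) :
    borderedAdj M l j l = 0 := by
  rw [← (borderedAdj_isSymm hM l).apply, borderedAdj_row]

/-- Outside row `l`, `M` and its bordered version differ only in column `l`, which meets a zero row
of `borderedAdj M l`. -/
theorem mul_borderedAdj_of_ne {M : Matrix (Fin n) (Fin n) ℝ} (hM : M.IsSymm) {l i : Fin n}
    (hi : i ≠ l) (j : Fin n) :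
    (M * borderedAdj M l) i j = if i = j then M.adjugate l l else 0 := by
  by_cases hj : j = l
  · subst hj
    simp [mul_apply, borderedAdj_col hM, hi]
  have h : (bordered M l * (bordered M l).adjugate) i j =
      if i = j then M.adjugate l l else 0 := by
    rw [mul_adjugate, det_bordered]; simp [one_apply]
  rw [← h, mul_apply, mul_apply]
  refine Finset.sum_congr rfl fun k _ => ?_
  by_cases hk : k = l
  · subst hk
    rw [borderedAdj_row, bordered_adjugate_row, if_neg (Ne.symm hj), mul_zero, mul_zero]
  · rw [bordered_apply, if_neg hk, if_neg hi, borderedAdj, Matrix.sub_apply, single_apply,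
      if_neg (fun e => hk e.1.symm), sub_zero]

/-- Row `l` is recovered from singularity: in row `l` of `adj M * (M * S) = 0` only two terms
survive, and both contain the nonzero factor `M.adjugate l l`. -/
theorem mul_borderedAdj_last {M : Matrix (Fin n) (Fin n) ℝ} (hM : M.IsSymm) {l j : Fin n}
    (hj : j ≠ l) (hdet : M.det = 0) (hD : M.adjugate l l ≠ 0) :
    (M * borderedAdj M l) l j = -M.adjugate j l := by
  have h0 : (M.adjugate * (M * borderedAdj M l)) l j = 0 := by
    rw [← Matrix.mul_assoc, adjugate_mul, hdet, zero_smul, Matrix.zero_mul, Matrix.zero_apply]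
  rw [mul_apply, ← Finset.add_sum_erase _ _ (Finset.mem_univ l), Finset.sum_eq_single j] at h0
  · rw [mul_borderedAdj_of_ne hM hj, if_pos rfl] at h0
    rw [mul_comm _ (M.adjugate l l), ← mul_add] at h0
    have := (mul_eq_zero.mp h0).resolve_left hD
    linarith [hM.adjugate.apply l j]
  · intro b hb hbj
    rw [mul_borderedAdj_of_ne hM (Finset.ne_of_mem_erase hb), if_neg hbj, mul_zero]
  · intro h
    exact absurd (Finset.mem_erase.mpr ⟨hj, Finset.mem_univ _⟩) h

/-- As `l` is the last index, the sign is the same for all `i ≠ l`; this constant cancels the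
diagonal of `(t I - L) S` in `P'_covec_borderedAdj`. -/
theorem P'_single_inl (z : Phase n) {l : Fin n} (hl : (l : ℕ) + 1 = n) (t : ℝ) (i : Fin n) :
    (P' z *ᵥ Pi.single (Sum.inl l) 1) (Sum.inl i) -
      t * (P z *ᵥ Pi.single (Sum.inl l) 1) (Sum.inl i) = if i = l then 0 else -1 := by
  rw [P'_mulVec_inl, P_mulVec]
  rw [Finset.sum_eq_single l]
  · have := i.2
    simp only [Pi.single_eq_same, Sum.elim_inl, Fin.lt_def, Fin.ext_iff]
    rw [Pi.single_eq_of_ne (by simp)]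
    split_ifs <;> first | (exfalso; omega) | simp
  · intro b _ hb
    rw [Pi.single_eq_of_ne (by simpa using hb), mul_zero]
  · simp

theorem P'_single_inr (z : Phase n) (l : Fin n) (t : ℝ) (i : Fin n) :
    (P' z *ᵥ Pi.single (Sum.inl l) 1) (Sum.inr i) -
      t * (P z *ᵥ Pi.single (Sum.inl l) 1) (Sum.inr i) = if i = l then t - p z l else 0 := by
  rw [P'_mulVec_inr, P_mulVec]
  by_cases h : i = l
  · subst h
    simp
    ring
  · simp [h, Pi.single_apply]

theorem sum_upper_mul_adjugate (z : Phase n) {l : Fin n} (hl : (l : ℕ) + 1 = n) (t : ℝ)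
    (hdet : (shifted z t).det = 0) :
    ∑ k, upper z k l * (shifted z t).adjugate k l =
      (t - p z l) * (shifted z t).adjugate l l := by
  have h : (shifted z t * (shifted z t).adjugate) l l = 0 := by
    rw [mul_adjugate, hdet, zero_smul, Matrix.zero_apply]
  rw [shifted_mul_apply, sub_eq_zero] at h
  rw [h]
  refine Finset.sum_congr rfl fun k _ => ?_
  rw [upper_of_ne z (j := l) (k := k) (by omega), zero_add]

/-- The covector `D dq_l - tr (S dL)`, where `D` is the principal minor of `t I - L` without the
last row and column and `S` its bordered adjugate, is an eigenvector of the recursion relation. -/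
theorem P'_covec_borderedAdj (z : Phase n) {l : Fin n} (hl : (l : ℕ) + 1 = n) (t : ℝ)
    (hdet : (shifted z t).det = 0) (hD : (shifted z t).adjugate l l ≠ 0) :
    P' z *ᵥ ((shifted z t).adjugate l l • Pi.single (Sum.inl l) 1 -
        covec z (borderedAdj (shifted z t) l)) =
      t • (P z *ᵥ ((shifted z t).adjugate l l • Pi.single (Sum.inl l) 1 -
        covec z (borderedAdj (shifted z t) l))) := by
  have hM := shifted_isSymm z t
  have hS := borderedAdj_isSymm hM l
  simp only [mulVec_sub, mulVec_smul]
  ext (i | i)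
  · have h1 := P'_covec_inl z t _ hS i
    have h2 := P'_single_inl z hl t i
    simp only [Pi.sub_apply, Pi.smul_apply, smul_eq_mul]
    by_cases hi : i = l
    · subst hi
      rw [mul_apply] at h1
      simp only [borderedAdj_col hM, mul_zero, Finset.sum_const_zero, neg_zero] at h1
      rw [if_pos rfl] at h2
      linear_combination (shifted z t).adjugate i i * h2 - h1
    · rw [mul_borderedAdj_of_ne hM hi, if_pos rfl] at h1
      rw [if_neg hi] at h2
      linear_combination (shifted z t).adjugate l l * h2 - h1
  · have h1 := P'_covec_inr z t _ hS i
    have h2 := P'_single_inr z l t i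
    simp only [Pi.sub_apply, Pi.smul_apply, smul_eq_mul]
    by_cases hi : i = l
    · subst hi
      rw [if_pos rfl] at h2
      have h3 : ∑ k, (upper z i k - upper z k i) *
          (shifted z t * borderedAdj (shifted z t) i) i k =
          ∑ k, upper z k i * (shifted z t).adjugate k i := by
        refine Finset.sum_congr rfl fun k _ => ?_
        by_cases hk : k = i
        · subst hk; rw [upper_self]; ring
        · rw [mul_borderedAdj_last hM hk hdet hD, upper_of_ne z (j := i) (k := k) (by omega)]
          ring
      rw [h3, sum_upper_mul_adjugate z hl t hdet] at h1
      linear_combination (shifted z t).adjugate i i * h2 - h1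
    · rw [if_neg hi] at h2
      have h3 : ∑ k, (upper z i k - upper z k i) *
          (shifted z t * borderedAdj (shifted z t) l) i k = 0 := by
        refine Finset.sum_eq_zero fun k _ => ?_
        rw [mul_borderedAdj_of_ne hM hi]
        split_ifs with e
        · subst e; rw [upper_self]; ring
        · ring
      rw [h3] at h1
      linear_combination (shifted z t).adjugate l l * h2 - h1

/-! ### Spectrum of the Lax matrix -/

/-- A vector annihilated by `t I - L` whose last component vanishes is zero. -/
theorem eq_zero_of_shifted_mulVec_eq_zero (z : Phase n) {l : Fin n} (hl : (l : ℕ) + 1 = n)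
    (t : ℝ) (x : Fin n → ℝ) (hx : shifted z t *ᵥ x = 0) (hxl : x l = 0) : x = 0 := by
  have key : ∀ m : ℕ, ∀ i : Fin n, n ≤ (i : ℕ) + 1 + m → x i = 0 := by
    intro m
    induction m using Nat.strong_induction_on with
    | _ m ih =>
      intro i hi
      by_cases hil : (i : ℕ) + 1 = n
      · rwa [show i = l from Fin.ext (by omega)]
      have := i.2
      have hm : 0 < m := by omega
      let j : Fin n := ⟨i + 1, by omega⟩
      have hj : (j : ℕ) = i + 1 := rfl
      -- In row `i + 1` the components of `x` at `i + 1` and `i + 2` are already zero, so `x i`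
      -- times a nonzero exponential is all that is left.
      have h := congrFun hx j
      rw [shifted_mulVec_apply, ih (m - 1) (by omega) j (by omega), Finset.sum_eq_single i] at h
      · rw [upper_of_ne z (j := j) (k := i) (by omega)] at h
        have hu : upper z i j ≠ 0 := by
          simp [upper, hj, Real.exp_ne_zero]
        simpa [hu] using h
      · intro b _ hb
        by_cases hbj : (b : ℕ) = j + 1
        · rw [ih (m - 1) (by omega) b (by omega), mul_zero]
        · rw [upper_of_ne z hbj, upper_of_ne z (j := b) (k := j)
            (fun e => hb (Fin.ext (by omega))), add_zero, zero_mul]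
      · simp
  funext i
  exact key n i (by omega)

/-- If the minor vanished, the bordered matrix would kill some `x ≠ 0` with `x l = 0`, so `(t I - L)
x` would vanish off row `l`. Pairing with a kernel vector `v` of `t I - L`, for which `v l ≠ 0`,
clears row `l` as well, and the three-term recursion gives `x = 0`. -/
theorem adjugate_shifted_ne_zero (z : Phase n) {l : Fin n} (hl : (l : ℕ) + 1 = n) (t : ℝ)
    (hdet : (shifted z t).det = 0) : (shifted z t).adjugate l l ≠ 0 := by
  intro hD
  have hM := shifted_isSymm z t
  rw [← det_bordered] at hD
  obtain ⟨x, hx0, hx⟩ := exists_mulVec_eq_zero_iff.mpr hD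
  obtain ⟨v, hv0, hv⟩ := exists_mulVec_eq_zero_iff.mpr hdet
  have hvl : v l ≠ 0 := fun h => hv0 (eq_zero_of_shifted_mulVec_eq_zero z hl t v hv h)
  have hxl : x l = 0 := by
    have := congrFun hx l
    rw [mulVec, dotProduct, Finset.sum_eq_single l] at this
    · simpa [bordered_apply] using this
    · intro b _ hb; simp [bordered_apply, hb]
    · simp
  have hne : ∀ i, i ≠ l → (shifted z t *ᵥ x) i = 0 := by
    intro i hi
    refine Eq.trans ?_ (congrFun hx i)
    simp only [mulVec, dotProduct]
    refine Finset.sum_congr rfl fun k _ => ?_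
    by_cases hk : k = l
    · rw [hk, hxl, mul_zero, mul_zero]
    · simp [bordered_apply, hk, hi]
  have hlast : (shifted z t *ᵥ x) l = 0 := by
    have h : v ⬝ᵥ (shifted z t *ᵥ x) = 0 := by
      rw [dotProduct_mulVec, ← mulVec_transpose, hM.eq, hv, zero_dotProduct]
    rw [dotProduct, Finset.sum_eq_single l] at h
    · exact (mul_eq_zero.mp h).resolve_left hvl
    · intro b _ hb; rw [hne b hb, mul_zero]
    · simp
  refine hx0 (eq_zero_of_shifted_mulVec_eq_zero z hl t x ?_ hxl)
  funext i
  by_cases hi : i = l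
  · rw [hi]; exact hlast
  · exact hne i hi

theorem lax_isHermitian (z : Phase n) : (lax z).IsHermitian := by
  rw [IsHermitian, conjTranspose_eq_transpose_of_trivial]
  exact (lax_isSymm z).eq

theorem shifted_mulVec (z : Phase n) (t : ℝ) (x : Fin n → ℝ) :
    shifted z t *ᵥ x = t • x - lax z *ᵥ x := by
  rw [shifted, sub_mulVec]
  congr 1
  ext i
  simp [scalar_apply, mulVec_diagonal]

theorem eigenvalues_injective (z : Phase n) :
    Function.Injective (lax_isHermitian z).eigenvalues := by
  intro i j hij
  by_contra hne
  set b := (lax_isHermitian z).eigenvectorBasis with hb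
  set t := (lax_isHermitian z).eigenvalues i with ht
  let l : Fin n := ⟨n - 1, by have := i.2; omega⟩
  have hl : (l : ℕ) + 1 = n := by have := i.2; simp only [l]; omega
  have hi : lax z *ᵥ (b i).ofLp = t • (b i).ofLp := (lax_isHermitian z).mulVec_eigenvectorBasis i
  have hj : lax z *ᵥ (b j).ofLp = t • (b j).ofLp := by
    rw [hij]; exact (lax_isHermitian z).mulVec_eigenvectorBasis j
  have hi0 : (b i).ofLp l ≠ 0 := by
    intro h
    have := eq_zero_of_shifted_mulVec_eq_zero z hl t _
      (by rw [shifted_mulVec, hi, sub_self]) h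
    exact b.orthonormal.ne_zero i ((WithLp.ofLp_eq_zero 2).mp this)
  -- This combination of two eigenvectors is chosen to have last component zero, so it vanishes,
  -- against orthonormality.
  have hw := eq_zero_of_shifted_mulVec_eq_zero z hl t
    ((b j).ofLp l • (b i).ofLp - (b i).ofLp l • (b j).ofLp)
    (by rw [shifted_mulVec, mulVec_sub, mulVec_smul, mulVec_smul, hi, hj]; module)
    (by simp [mul_comm])
  have hw' : (b j).ofLp l • b i - (b i).ofLp l • b j = 0 := by
    apply (WithLp.ofLp_eq_zero 2).mp
    simpa using hw
  have h := congrArg (fun x => inner ℝ (b j) x) hw'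
  simp only [inner_sub_right, inner_smul_right, inner_zero_right] at h
  rw [b.orthonormal.2 (Ne.symm hne), real_inner_self_eq_norm_sq, b.orthonormal.1 j] at h
  apply hi0
  linarith

/-! ### The roots of the characteristic polynomial -/

/-- Frees later arguments from the sorted list: any increasing factorization of `A` identifies the
roots, and the default value of `getD` is never reached. -/
theorem lam_eq_of_prod (z : Phase n) (ℓ : Fin n → ℝ) (hℓ : StrictMono ℓ)
    (hA : A z = ∏ i, (X - C (ℓ i))) (i : Fin n) : lam i z = ℓ i := by
  have hroots : (A z).roots = (List.ofFn ℓ : Multiset ℝ) := by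
    rw [hA, roots_prod _ _ (Finset.prod_ne_zero_iff.mpr fun i _ => X_sub_C_ne_zero _)]
    simp [Fin.univ_val_map]
  have hsort : (A z).roots.sort (· ≤ ·) = List.ofFn ℓ := by
    rw [hroots, Multiset.coe_sort]
    apply List.mergeSort_of_pairwise
    simp_rw [decide_eq_true_eq, ← List.sortedLE_iff_pairwise]
    exact hℓ.monotone.sortedLE_ofFn
  rw [lam, hsort, List.getD_eq_getElem _ _ (by simp)]
  simp

theorem exists_strictMono_prod (z : Phase n) :
    ∃ ℓ : Fin n → ℝ, StrictMono ℓ ∧ A z = ∏ i, (X - C (ℓ i)) := by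
  set ev := (lax_isHermitian z).eigenvalues with hev
  refine ⟨ev ∘ Tuple.sort ev, (Tuple.monotone_sort ev).strictMono_of_injective
    ((eigenvalues_injective z).comp (Tuple.sort ev).injective), ?_⟩
  rw [A, (lax_isHermitian z).charpoly_eq]
  exact (Equiv.prod_comp (Tuple.sort ev) fun i => X - C (ev i)).symm

theorem lam_strictMono (z : Phase n) : StrictMono fun i => lam i z := by
  obtain ⟨ℓ, hℓ, hA⟩ := exists_strictMono_prod z
  simpa only [lam_eq_of_prod z ℓ hℓ hA] using hℓ

theorem A_eq_prod (z : Phase n) : A z = ∏ i, (X - C (lam i z)) := by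
  obtain ⟨ℓ, hℓ, hA⟩ := exists_strictMono_prod z
  simpa only [lam_eq_of_prod z ℓ hℓ hA] using hA

theorem eval_A (z : Phase n) (t : ℝ) : (A z).eval t = (shifted z t).det :=
  eval_charpoly _ _

theorem eval_A_lam (z : Phase n) (i : Fin n) : (A z).eval (lam i z) = 0 := by
  rw [A_eq_prod, eval_prod]
  exact Finset.prod_eq_zero (Finset.mem_univ i) (by simp)

theorem det_shifted_lam (z : Phase n) (i : Fin n) : (shifted z (lam i z)).det = 0 := by
  rw [← eval_A, eval_A_lam]

theorem eval_derivative_A_ne_zero (z : Phase n) (i : Fin n) :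
    (A z).derivative.eval (lam i z) ≠ 0 := by
  have hs : (A z).Separable := by
    rw [A_eq_prod]
    exact separable_prod_X_sub_C_iff.mpr (lam_strictMono z).injective
  simpa [coe_aeval_eq_eval] using
    hs.aeval_derivative_ne_zero (x := lam i z) (by simp [coe_aeval_eq_eval, eval_A_lam])

theorem sum_lam (z : Phase n) : ∑ i, lam i z = ∑ i, p z i := by
  have hroots : (A z).roots.sum = ∑ i, lam i z := by
    rw [A_eq_prod, roots_prod _ _ (Finset.prod_ne_zero_iff.mpr fun i _ => X_sub_C_ne_zero _)]
    simp [List.sum_ofFn]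
  have hsplits : (lax z).charpoly.Splits := (lax_isHermitian z).splits_charpoly
  rw [← hroots, A, ← trace_eq_sum_roots_charpoly_of_splits hsplits]
  exact Finset.sum_congr rfl fun i _ => by simp [lax]

/-! ### The numerator of the Weyl function -/

theorem alpha_eq (z : Phase n) {l : Fin n} (hl : (l : ℕ) + 1 = n) :
    alpha z = Pi.single l (Real.exp (q z l / 2)) := by
  ext j
  rw [alpha, Pi.single_apply]
  by_cases h : j = l
  · rw [if_pos h, if_pos (by rw [h, hl]), h]
  · rw [if_neg h, if_neg fun e => h (Fin.ext (by omega))]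

theorem B_eq (z : Phase n) {l : Fin n} (hl : (l : ℕ) + 1 = n) :
    B z = -(C (Real.exp (q z l)) * (charmatrix (lax z)).adjugate l l) := by
  have h : (fun j => C (alpha z j)) = Pi.single l (C (Real.exp (q z l / 2))) := by
    ext1 j
    rw [alpha_eq z hl]
    by_cases h : j = l
    · subst h; simp
    · simp [h]
  rw [B, h, dotProduct_single, mulVec_single]
  simp only [Pi.smul_apply, MulOpposite.smul_eq_mul_unop, MulOpposite.unop_op, col_apply]
  rw [show q z l = q z l / 2 + q z l / 2 by ring, Real.exp_add, C_mul,
    show (q z l / 2 + q z l / 2) / 2 = q z l / 2 by ring]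
  ring

theorem eval_adjugate_charmatrix (z : Phase n) (t : ℝ) (i j : Fin n) :
    ((charmatrix (lax z)).adjugate i j).eval t = (shifted z t).adjugate i j := by
  have h := (evalRingHom t).map_adjugate (charmatrix (lax z))
  have h2 : (evalRingHom t).mapMatrix (charmatrix (lax z)) = shifted z t := by
    ext i j
    simp [charmatrix, shifted, scalar_apply, diagonal_apply, apply_ite (eval t)]
  rw [h2] at h
  exact congrFun (congrFun h i) j

theorem eval_B (z : Phase n) {l : Fin n} (hl : (l : ℕ) + 1 = n) (t : ℝ) :
    (B z).eval t = -(Real.exp (q z l) * (shifted z t).adjugate l l) := by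
  rw [B_eq z hl, eval_neg, eval_mul, eval_C, eval_adjugate_charmatrix]

theorem eval_B_lam_ne_zero (z : Phase n) (i : Fin n) : (B z).eval (lam i z) ≠ 0 := by
  let l : Fin n := ⟨n - 1, by have := i.2; omega⟩
  have hl : (l : ℕ) + 1 = n := by have := i.2; simp only [l]; omega
  rw [eval_B z hl, neg_ne_zero]
  exact mul_ne_zero (Real.exp_ne_zero _)
    (adjugate_shifted_ne_zero z hl _ (det_shifted_lam z i))

theorem weyl_eq (z : Phase n) {l : Fin n} (hl : (l : ℕ) + 1 = n) (t : ℝ)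
    (ht : (A z).eval t ≠ 0) : weyl z t = (B z).eval t / (A z).eval t := by
  have h1 : lax z - t • (1 : Matrix (Fin n) (Fin n) ℝ) = -shifted z t := by
    rw [shifted, scalar_apply, smul_one_eq_diagonal, neg_sub]
  have h2 : (-shifted z t)⁻¹ = -(shifted z t)⁻¹ := by
    rw [← neg_one_smul ℝ (shifted z t), ← neg_one_smul ℝ (shifted z t)⁻¹]
    simpa using inv_smul' (A := shifted z t) (-1 : ℝˣ)
      (by rw [← eval_A]; exact isUnit_iff_ne_zero.mpr ht)
  rw [weyl, h1, h2, alpha_eq z hl, dotProduct_single, mulVec_single, eval_B z hl, eval_A, inv_def]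
  simp only [Pi.smul_apply, MulOpposite.smul_eq_mul_unop, MulOpposite.unop_op, col_apply,
    Matrix.neg_apply, Matrix.smul_apply, smul_eq_mul, Ring.inverse_eq_inv']
  rw [show Real.exp (q z l) = Real.exp (q z l / 2) * Real.exp (q z l / 2) by
    rw [← Real.exp_add]; congr 1; ring]
  ring

theorem adjugate_charmatrix_monic (M : Matrix (Fin n) (Fin n) ℝ) (l : Fin n) :
    ((charmatrix M).adjugate l l).Monic ∧ ((charmatrix M).adjugate l l).natDegree = n - 1 := by
  cases n with
  | zero => exact l.elim0
  | succ m =>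
    have h : (charmatrix M).adjugate l l =
        (M.submatrix l.succAbove l.succAbove).charpoly := by
      rw [adjugate_fin_succ_eq_det_submatrix, Even.neg_one_pow ⟨(l : ℕ), rfl⟩, one_mul, charpoly]
      congr 1
      ext1 i j
      simp [charmatrix_apply, diagonal_apply]
    rw [h]
    exact ⟨charpoly_monic _, by simp [charpoly_natDegree_eq_dim]⟩

theorem natDegree_B (z : Phase n) {l : Fin n} (hl : (l : ℕ) + 1 = n) :
    (B z).natDegree = n - 1 := by
  rw [B_eq z hl, natDegree_neg, natDegree_C_mul (Real.exp_ne_zero _)]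
  exact (adjugate_charmatrix_monic _ l).2

theorem leadingCoeff_B (z : Phase n) {l : Fin n} (hl : (l : ℕ) + 1 = n) :
    (B z).leadingCoeff = -Real.exp (q z l) := by
  rw [B_eq z hl, leadingCoeff_neg, leadingCoeff_mul, leadingCoeff_C,
    (adjugate_charmatrix_monic _ l).1.leadingCoeff, mul_one]

/-! ### Differentials -/

/-- Jacobi's formula: the determinant is multilinear in the rows, and replacing one row gives an
adjugate pairing by Cramer's rule. -/
theorem hasFDerivAt_det {m : ℕ} {E : Type*} [NormedAddCommGroup E] [NormedSpace ℝ E]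
    {M : E → Matrix (Fin m) (Fin m) ℝ} {x : E} {M' : Fin m → Fin m → E →L[ℝ] ℝ}
    (hM : ∀ i j, HasFDerivAt (fun y => M y i j) (M' i j) x) :
    HasFDerivAt (fun y => (M y).det) (∑ i, ∑ j, (M x).adjugate j i • M' i j) x := by
  let D : ContinuousMultilinearMap ℝ (fun _ : Fin m => Fin m → ℝ) ℝ :=
    { toMultilinearMap := (detRowAlternating (R := ℝ) (n := Fin m)).toMultilinearMap
      cont := Continuous.matrix_det (A := fun v : Fin m → Fin m → ℝ => Matrix.of v) continuous_id }
  have hrow : HasFDerivAt (fun y i j => M y i j)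
      (ContinuousLinearMap.pi fun i => ContinuousLinearMap.pi fun j => M' i j) x :=
    hasFDerivAt_pi.mpr fun i => hasFDerivAt_pi.mpr fun j => hM i j
  have h : HasFDerivAt (fun y => D fun i j => M y i j) _ x :=
    (D.hasFDerivAt fun i j => M x i j).comp x hrow
  refine h.congr_fderiv ?_
  ext v
  simp only [ContinuousLinearMap.comp_apply, ContinuousMultilinearMap.linearDeriv_apply,
    _root_.sum_apply, _root_.smul_apply, smul_eq_mul]
  refine Finset.sum_congr rfl fun i _ => ?_
  change ((M x).updateRow i fun j => M' i j v).det = _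
  rw [← cramer_transpose_apply, cramer_eq_adjugate_mulVec, ← adjugate_transpose]
  simp [mulVec, dotProduct]

theorem d_det {M : Phase n → Matrix (Fin n) (Fin n) ℝ} {z : Phase n}
    (hM : ∀ i j, DifferentiableAt ℝ (fun y => M y i j) z) (a : Coord n) :
    d (fun y => (M y).det) z a = ∑ i, ∑ j, (M z).adjugate j i * d (fun y => M y i j) z a := by
  rw [d, (hasFDerivAt_det fun i j => (hM i j).hasFDerivAt).fderiv]
  simp [d]

theorem contDiff_det {m : ℕ} {E : Type*} [NormedAddCommGroup E] [NormedSpace ℝ E]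
    {M : E → Matrix (Fin m) (Fin m) ℝ} {k : WithTop ℕ∞}
    (hM : ∀ i j, ContDiff ℝ k fun y => M y i j) : ContDiff ℝ k fun y => (M y).det := by
  simp only [det_apply']
  exact ContDiff.sum fun σ _ => contDiff_const.mul (contDiff_prod fun i _ => hM _ _)

theorem hasFDerivAt_q (z : Phase n) (i : Fin n) : HasFDerivAt (fun y : Phase n => q y i)
    (ContinuousLinearMap.proj (R := ℝ) (φ := fun _ : Coord n => ℝ) (Sum.inl i)) z :=
  (ContinuousLinearMap.proj (R := ℝ) (φ := fun _ : Coord n => ℝ) (Sum.inl i)).hasFDerivAt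

theorem hasFDerivAt_p (z : Phase n) (i : Fin n) : HasFDerivAt (fun y : Phase n => p y i)
    (ContinuousLinearMap.proj (R := ℝ) (φ := fun _ : Coord n => ℝ) (Sum.inr i)) z :=
  (ContinuousLinearMap.proj (R := ℝ) (φ := fun _ : Coord n => ℝ) (Sum.inr i)).hasFDerivAt

theorem contDiff_q {k : WithTop ℕ∞} (i : Fin n) : ContDiff ℝ k fun y : Phase n => q y i :=
  contDiff_apply ℝ ℝ (Sum.inl i)

theorem contDiff_p {k : WithTop ℕ∞} (i : Fin n) : ContDiff ℝ k fun y : Phase n => p y i :=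
  contDiff_apply ℝ ℝ (Sum.inr i)

theorem contDiff_lax {k : WithTop ℕ∞} (i j : Fin n) :
    ContDiff ℝ k fun y : Phase n => lax y i j := by
  unfold lax
  simp only [of_apply]
  split_ifs
  · exact contDiff_p i
  · exact (((contDiff_q i).sub (contDiff_q j)).div_const 2).exp
  · exact (((contDiff_q j).sub (contDiff_q i)).div_const 2).exp
  · exact contDiff_const

theorem shifted_apply (z : Phase n) (t : ℝ) (i j : Fin n) :
    shifted z t i j = (if i = j then t else 0) - lax z i j := by
  simp [shifted, scalar_apply, diagonal_apply]

theorem contDiff_shifted {k : WithTop ℕ∞} (i j : Fin n) :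
    ContDiff ℝ k fun y : Phase n × ℝ => shifted y.1 y.2 i j := by
  simp only [shifted_apply]
  refine ContDiff.sub ?_ ((contDiff_lax i j).comp contDiff_fst)
  split_ifs
  · exact contDiff_snd
  · exact contDiff_const

theorem contDiff_bordered_shifted {k : WithTop ℕ∞} (l i j : Fin n) :
    ContDiff ℝ k fun y : Phase n × ℝ => bordered (shifted y.1 y.2) l i j := by
  simp only [bordered_apply]
  split_ifs
  · exact contDiff_const
  · exact contDiff_const
  · exact contDiff_const
  · exact contDiff_shifted i j

theorem contDiff_eval_A {k : WithTop ℕ∞} :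
    ContDiff ℝ k fun y : Phase n × ℝ => (A y.1).eval y.2 := by
  simp only [eval_A]
  exact contDiff_det contDiff_shifted

theorem contDiff_adjugate_shifted {k : WithTop ℕ∞} (l : Fin n) :
    ContDiff ℝ k fun y : Phase n × ℝ => (shifted y.1 y.2).adjugate l l := by
  simp only [← det_bordered]
  exact contDiff_det (contDiff_bordered_shifted l)

theorem contDiff_eval_B {l : Fin n} (hl : (l : ℕ) + 1 = n) {k : WithTop ℕ∞} :
    ContDiff ℝ k fun y : Phase n × ℝ => (B y.1).eval y.2 := by
  simp only [eval_B _ hl]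
  exact ((((contDiff_q l).comp contDiff_fst).exp).mul (contDiff_adjugate_shifted l)).neg

theorem d_upper (z : Phase n) (i j : Fin n) (a : Coord n) :
    d (fun y => upper y i j) z a =
      upper z i j / 2 * ((Pi.single a 1 : Phase n) (Sum.inl i) -
        (Pi.single a 1 : Phase n) (Sum.inl j)) := by
  by_cases h : (j : ℕ) = i + 1
  · have h1 : (fun y : Phase n => upper y i j) = fun y => Real.exp ((q y i - q y j) / 2) := by
      ext y; simp [upper, h]
    have h2 : HasFDerivAt (fun y : Phase n => Real.exp ((q y i - q y j) / 2))
        (Real.exp ((q z i - q z j) * 2⁻¹) • (2⁻¹ : ℝ) •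
          (ContinuousLinearMap.proj (R := ℝ) (φ := fun _ : Coord n => ℝ) (Sum.inl i) -
            ContinuousLinearMap.proj (R := ℝ) (φ := fun _ : Coord n => ℝ) (Sum.inl j))) z :=
      (((hasFDerivAt_q z i).sub (hasFDerivAt_q z j)).mul_const (2⁻¹ : ℝ)).exp
    rw [d, h1, h2.fderiv, upper, of_apply, if_pos h]
    simp only [_root_.smul_apply, _root_.sub_apply,
      ContinuousLinearMap.proj_apply, smul_eq_mul]
    ring_nf
  · have h1 : (fun y : Phase n => upper y i j) = fun _ => 0 := by
      ext y; exact upper_of_ne y h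
    rw [d, h1, upper_of_ne z h]
    simp

theorem d_p (z : Phase n) (i : Fin n) (a : Coord n) :
    d (fun y => p y i) z a = (Pi.single a 1 : Phase n) (Sum.inr i) := by
  rw [d, (hasFDerivAt_p z i).fderiv]
  rfl

theorem d_q (z : Phase n) (i : Fin n) : d (fun y => q y i) z = Pi.single (Sum.inl i) 1 := by
  ext a
  rw [d, (hasFDerivAt_q z i).fderiv]
  simp [Pi.single_apply, eq_comm]

theorem contDiff_upper {k : WithTop ℕ∞} (i j : Fin n) :
    ContDiff ℝ k fun y : Phase n => upper y i j := by
  unfold upper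
  simp only [of_apply]
  split_ifs
  · exact (((contDiff_q i).sub (contDiff_q j)).div_const 2).exp
  · exact contDiff_const

theorem d_lax (z : Phase n) (i j : Fin n) (a : Coord n) :
    d (fun y => lax y i j) z a =
      (if i = j then (Pi.single a 1 : Phase n) (Sum.inr i) else 0) +
        d (fun y => upper y i j) z a + d (fun y => upper y j i) z a := by
  have h1 : (fun y : Phase n => lax y i j) =
      fun y => (if i = j then p y i else 0) + upper y i j + upper y j i := by
    ext y; rw [lax_eq]; simp [diagonal_apply]
  have hp : DifferentiableAt ℝ (fun y : Phase n => if i = j then p y i else 0) z := by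
    split_ifs
    · exact (hasFDerivAt_p z i).differentiableAt
    · exact differentiableAt_const _
  have hu : ∀ i j, DifferentiableAt ℝ (fun y : Phase n => upper y i j) z := fun i j =>
    ((contDiff_upper (k := 1) i j).differentiable one_ne_zero) z
  have h2 : HasFDerivAt
      (fun y : Phase n => (if i = j then p y i else 0) + upper y i j + upper y j i) _ z :=
    (hp.hasFDerivAt.add (hu i j).hasFDerivAt).add (hu j i).hasFDerivAt
  rw [h1, d, h2.fderiv]
  simp only [_root_.add_apply]
  congr 2
  split_ifs
  · exact d_p z i a
  · simp

/-- Justifies reading `covec` as `tr (S dL)`: the two symmetric off-diagonal entries compensate the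
`1/2` in the exponent. -/
theorem sum_mul_d_lax (z : Phase n) (S : Matrix (Fin n) (Fin n) ℝ) (hS : S.IsSymm)
    (a : Coord n) : ∑ i, ∑ j, S j i * d (fun y => lax y i j) z a = covec z S a := by
  have hswap : ∑ i, ∑ j, S j i * d (fun y => upper y j i) z a =
      ∑ i, ∑ j, S j i * d (fun y => upper y i j) z a := by
    rw [Finset.sum_comm]
    simp only [hS.apply]
  simp only [d_lax, mul_add, Finset.sum_add_distrib, hswap]
  rcases a with m | m
  · simp only [d_upper, covec, Sum.elim_inl, Pi.single_apply, Sum.inl.injEq, reduceCtorEq,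
      if_false, ite_self, mul_zero, Finset.sum_const_zero, zero_add, mul_sub,
      Finset.sum_sub_distrib, mul_ite, mul_one, Finset.sum_ite_eq', Finset.mem_univ, if_true]
    have h : ∑ i, ∑ j, (if i = m then S j i * (upper z i j / 2) else 0) =
        ∑ j, S j m * (upper z m j / 2) := by
      rw [Finset.sum_comm]; simp
    simp only [h, hS.apply m]
    rw [← Finset.sum_sub_distrib, ← Finset.sum_add_distrib, ← Finset.sum_sub_distrib]
    exact Finset.sum_congr rfl fun k _ => by ring
  · simp [d_upper, covec, Pi.single_apply]

theorem d_shifted (z : Phase n) (t : ℝ) (i j : Fin n) (a : Coord n) :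
    d (fun y => shifted y t i j) z a = -d (fun y => lax y i j) z a := by
  simp only [d, shifted_apply]
  rw [fderiv_const_sub]
  rfl

theorem contDiff_fixed {G : Phase n × ℝ → ℝ} {k : WithTop ℕ∞} (hG : ContDiff ℝ k G) (t : ℝ) :
    ContDiff ℝ k fun y => G (y, t) :=
  hG.comp (contDiff_id.prodMk contDiff_const)

theorem d_det_shifted (z : Phase n) (t : ℝ) :
    d (fun y => (shifted y t).det) z = -covec z (shifted z t).adjugate := by
  ext a
  rw [d_det fun i j => (contDiff_fixed (contDiff_shifted (k := 1) i j) t).differentiable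
    one_ne_zero z, Pi.neg_apply, ← sum_mul_d_lax z _ (shifted_isSymm z t).adjugate a]
  simp [d_shifted]

theorem d_adjugate_shifted (z : Phase n) (t : ℝ) (l : Fin n) :
    d (fun y => (shifted y t).adjugate l l) z = -covec z (borderedAdj (shifted z t) l) := by
  have hM := shifted_isSymm z t
  ext a
  simp only [← det_bordered]
  rw [d_det fun i j => (contDiff_fixed (contDiff_bordered_shifted (k := 1) l i j) t).differentiable
    one_ne_zero z, Pi.neg_apply, ← sum_mul_d_lax z _ (borderedAdj_isSymm hM l) a,
    ← Finset.sum_neg_distrib]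
  refine Finset.sum_congr rfl fun i _ => ?_
  rw [← Finset.sum_neg_distrib]
  refine Finset.sum_congr rfl fun j _ => ?_
  simp only [bordered_apply]
  by_cases hj : j = l
  · subst hj
    rw [borderedAdj_row]
    simp [d]
  by_cases hi : i = l
  · subst hi
    rw [borderedAdj_col hM]
    simp [d, hj]
  · simp only [hj, hi, if_false, d_shifted, borderedAdj, Matrix.sub_apply, single_apply,
      Ne.symm hj, false_and]
    ring

theorem d_eval_B (z : Phase n) {l : Fin n} (hl : (l : ℕ) + 1 = n) (t : ℝ) :
    d (fun y => (B y).eval t) z = -Real.exp (q z l) •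
      ((shifted z t).adjugate l l • Pi.single (Sum.inl l) 1 -
        covec z (borderedAdj (shifted z t) l)) := by
  have hq := hasFDerivAt_q z l
  have hD : DifferentiableAt ℝ (fun y : Phase n => (shifted y t).adjugate l l) z :=
    (contDiff_fixed (contDiff_adjugate_shifted (k := 1) l) t).differentiable one_ne_zero z
  have h : HasFDerivAt (fun y : Phase n => -(Real.exp (q y l) * (shifted y t).adjugate l l)) _ z :=
    (hq.exp.mul hD.hasFDerivAt).neg
  have hB : (fun y : Phase n => (B y).eval t) =
      fun y => -(Real.exp (q y l) * (shifted y t).adjugate l l) :=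
    funext fun y => eval_B y hl t
  ext a
  have h1 := congrFun (d_adjugate_shifted z t l) a
  have h2 := congrFun (d_q z l) a
  rw [d, hq.fderiv] at h2
  rw [d] at h1
  rw [hB, d, h.fderiv]
  simp only [_root_.neg_apply, _root_.add_apply,
    _root_.smul_apply, h1, h2, smul_eq_mul, Pi.smul_apply, Pi.sub_apply, Pi.neg_apply]
  ring

/-- The chain rule for `y ↦ G (y, g y)`. -/
theorem d_comp_graph {G : Phase n × ℝ → ℝ} {g : Phase n → ℝ} {z : Phase n}
    (hG : DifferentiableAt ℝ G (z, g z)) (hg : DifferentiableAt ℝ g z) :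
    d (fun y => G (y, g y)) z =
      d (fun y => G (y, g z)) z + deriv (fun t => G (z, t)) (g z) • d g z := by
  have h1 : HasFDerivAt (fun y => G (y, g y)) _ z :=
    HasFDerivAt.comp z (g := G) (f := fun y => (y, g y)) hG.hasFDerivAt
      ((hasFDerivAt_id z).prodMk hg.hasFDerivAt)
  have h2 : HasFDerivAt (fun y => G (y, g z)) _ z :=
    HasFDerivAt.comp z (g := G) (f := fun y => (y, g z)) hG.hasFDerivAt
      ((hasFDerivAt_id z).prodMk (hasFDerivAt_const (g z) z))
  have h3 : HasDerivAt (fun t => G (z, t)) _ (g z) :=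
    HasFDerivAt.comp_hasDerivAt (g z) (l := G) (f := fun t => (z, t)) hG.hasFDerivAt
      ((hasDerivAt_const (g z) z).prodMk (hasDerivAt_id (g z)))
  ext a
  simp only [d, Pi.add_apply, Pi.smul_apply, smul_eq_mul]
  rw [h1.fderiv, h2.fderiv, h3.deriv]
  set v : Phase n := Pi.single a 1
  have hv : ((v, fderiv ℝ g z v) : Phase n × ℝ) = (v, 0) + fderiv ℝ g z v • ((0 : Phase n), 1) := by
    simp
  simp only [ContinuousLinearMap.comp_apply, ContinuousLinearMap.prod_apply,
    ContinuousLinearMap.id_apply, _root_.zero_apply]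
  rw [hv, map_add, map_smul, smul_eq_mul, mul_comm]

/-! ### Smoothness of the Moser variables -/

theorem deriv_eval_A (z : Phase n) (t : ℝ) :
    deriv (fun s => (A z).eval s) t = (A z).derivative.eval t :=
  (A z).deriv

/-- Simplicity of the roots yields an implicit function `ψ j` through each one. Near `z` these stay
strictly ordered, so they are `n` distinct roots of a monic polynomial of degree `n`, and
`lam_eq_of_prod` identifies them with the sorted roots. -/
theorem contDiffAt_lam (i : Fin n) (z : Phase n) {k : ℕ∞} (hk : k ≠ 0) :
    ContDiffAt ℝ k (lam i) z := by
  have hk' : (k : WithTop ℕ∞) ≠ 0 := by exact_mod_cast hk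
  have hF : ContDiff ℝ k fun y : Phase n × ℝ => (A y.1).eval y.2 := contDiff_eval_A
  have hinv : ∀ j, (fderiv ℝ (fun y : Phase n × ℝ => (A y.1).eval y.2) (z, lam j z) ∘L
      .inr ℝ (Phase n) ℝ).IsInvertible := by
    intro j
    refine ⟨ContinuousLinearEquiv.unitsEquivAut ℝ
      (Units.mk0 _ (eval_derivative_A_ne_zero z j)), ?_⟩
    ext
    have h : HasDerivAt (fun t => (A z).eval t) _ (lam j z) :=
      HasFDerivAt.comp_hasDerivAt (lam j z) (l := fun y : Phase n × ℝ => (A y.1).eval y.2)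
        (f := fun t => (z, t)) ((hF.differentiable hk') _).hasFDerivAt
        ((hasDerivAt_const (lam j z) z).prodMk (hasDerivAt_id (lam j z)))
    have h2 := h.deriv
    rw [deriv_eval_A] at h2
    simpa using h2
  let ψ : Fin n → Phase n → ℝ := fun j => (hF.contDiffAt (x := (z, lam j z))).implicitFunction
    hk' (hinv j)
  have hψc : ∀ j, ContDiffAt ℝ k (ψ j) z := fun j =>
    ContDiffAt.contDiffAt_implicitFunction (hF.contDiffAt (x := (z, lam j z))) hk' (hinv j)
  have hψz : ∀ j, ψ j z = lam j z := fun j =>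
    ContDiffAt.implicitFunction_apply_self (hF.contDiffAt (x := (z, lam j z))) hk' (hinv j)
  have hψ0 : ∀ j, ∀ᶠ y in nhds z, (A y).eval (ψ j y) = 0 := by
    intro j
    filter_upwards [ContDiffAt.eventually_apply_implicitFunction
      (hF.contDiffAt (x := (z, lam j z))) hk' (hinv j)] with y hy
    exact hy.trans (eval_A_lam z j)
  have hlt : ∀ a b : Fin n, a < b → ∀ᶠ y in nhds z, ψ a y < ψ b y := by
    intro a b hab
    refine (hψc a).continuousAt.eventually_lt (hψc b).continuousAt ?_
    rw [hψz, hψz]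
    exact lam_strictMono z hab
  have hmono : ∀ᶠ y in nhds z, StrictMono fun j => ψ j y := by
    have : ∀ᶠ y in nhds z, ∀ a b : Fin n, a < b → ψ a y < ψ b y := by
      simp only [Filter.eventually_all]
      exact hlt
    filter_upwards [this] with y hy a b hab using hy a b hab
  refine (hψc i).congr_of_eventuallyEq ?_
  filter_upwards [hmono, Filter.eventually_all.mpr hψ0] with y hy hy0
  refine lam_eq_of_prod y (fun j => ψ j y) hy ?_ i
  have hmonic : (A y).Monic := charpoly_monic _
  have hdeg : (A y).natDegree = n := by simp [A, charpoly_natDegree_eq_dim]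
  have hdvd : (∏ j, (X - C (ψ j y))) ∣ A y := by
    refine Finset.prod_dvd_of_coprime (fun a _ b _ hab => ?_) fun j _ =>
      dvd_iff_isRoot.mpr (hy0 j)
    exact isCoprime_X_sub_C_of_isUnit_sub (sub_ne_zero.mpr (hy.injective.ne hab)).isUnit
  have hm2 : (∏ j, (X - C (ψ j y))).Monic := monic_prod_of_monic _ _ fun j _ => monic_X_sub_C _
  refine (eq_of_monic_of_dvd_of_natDegree_le hm2 hmonic hdvd ?_)
  rw [hdeg, natDegree_prod_of_monic _ _ fun j _ => monic_X_sub_C _]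
  simp

theorem differentiableAt_lam (i : Fin n) (z : Phase n) : DifferentiableAt ℝ (lam i) z :=
  (contDiffAt_lam i z (k := 1) one_ne_zero).differentiableAt (by simp)

theorem exists_last (i : Fin n) : ∃ l : Fin n, (l : ℕ) + 1 = n :=
  ⟨⟨n - 1, by have := i.2; omega⟩, by have := i.2; simp only; omega⟩

theorem contDiffAt_eval_B_lam (i : Fin n) (z : Phase n) {k : ℕ∞} (hk : k ≠ 0) :
    ContDiffAt ℝ k (fun y => (B y).eval (lam i y)) z := by
  obtain ⟨l, hl⟩ := exists_last i
  exact (contDiff_eval_B hl).contDiffAt.comp (f := fun y => (y, lam i y)) z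
    (contDiffAt_id.prodMk (contDiffAt_lam i z hk))

theorem contDiffAt_mu (i : Fin n) (z : Phase n) {k : ℕ∞} (hk : k ≠ 0) :
    ContDiffAt ℝ k (mu i) z :=
  (contDiffAt_eval_B_lam i z hk).log (eval_B_lam_ne_zero z i)

theorem differentiableAt_mu (i : Fin n) (z : Phase n) : DifferentiableAt ℝ (mu i) z :=
  (contDiffAt_mu i z (k := 1) one_ne_zero).differentiableAt (by simp)

/-! ### The differentials of the Moser variables as eigenvectors -/

/-- Differentiation of the identity `A(λ_i) = 0`, with the derivative at fixed `t` given by Jacobi's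
formula. -/
theorem d_lam (i : Fin n) (z : Phase n) :
    d (lam i) z =
      ((A z).derivative.eval (lam i z))⁻¹ • covec z (shifted z (lam i z)).adjugate := by
  have h := d_comp_graph (G := fun y : Phase n × ℝ => (A y.1).eval y.2)
    (contDiff_eval_A (k := 1).differentiable one_ne_zero _) (differentiableAt_lam i z)
  simp only [eval_A_lam, deriv_eval_A] at h
  simp only [eval_A, d_det_shifted] at h
  have h0 : d (fun _ : Phase n => (0 : ℝ)) z = 0 := by ext a; simp [d]
  rw [h0, eq_comm, neg_add_eq_zero] at h
  rw [h, smul_smul, inv_mul_cancel₀ (eval_derivative_A_ne_zero z i), one_smul]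

theorem P'_d_lam (i : Fin n) (z : Phase n) :
    P' z *ᵥ d (lam i) z = lam i z • (P z *ᵥ d (lam i) z) := by
  rw [d_lam, mulVec_smul, mulVec_smul, P'_covec_of_shifted_mul_eq_zero z (lam i z) _
    (shifted_isSymm z _).adjugate
    (by rw [mul_adjugate, det_shifted_lam, zero_smul]), smul_comm]

theorem d_log {f : Phase n → ℝ} {z : Phase n} (hf : DifferentiableAt ℝ f z) (h0 : f z ≠ 0) :
    d (fun y => Real.log (f y)) z = (f z)⁻¹ • d f z := by
  ext a
  rw [d, fderiv.log hf h0]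
  rfl

/-- By the chain rule `dμ_i` combines the differential of `B(t)` at fixed `t = λ_i` with `dλ_i`;
both are eigenvectors for `λ_i`. -/
theorem P'_d_mu (i : Fin n) (z : Phase n) :
    P' z *ᵥ d (mu i) z = lam i z • (P z *ᵥ d (mu i) z) := by
  obtain ⟨l, hl⟩ := exists_last i
  have hmu : d (mu i) z = _ := d_log
    ((contDiffAt_eval_B_lam i z (k := 1) one_ne_zero).differentiableAt (by simp))
    (eval_B_lam_ne_zero z i)
  have h := d_comp_graph (G := fun y : Phase n × ℝ => (B y.1).eval y.2)
    ((contDiff_eval_B hl (k := 1)).differentiable one_ne_zero _) (differentiableAt_lam i z)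
  simp only at h
  rw [hmu, h, d_eval_B z hl]
  have hB := P'_covec_borderedAdj z hl (lam i z) (det_shifted_lam z i)
    (adjugate_shifted_ne_zero z hl _ (det_shifted_lam z i))
  generalize (shifted z (lam i z)).adjugate l l • Pi.single (Sum.inl l) 1 -
    covec z (borderedAdj (shifted z (lam i z)) l) = η at hB
  simp only [mulVec_smul, mulVec_add, hB, P'_d_lam]
  module

/-! ### Brackets -/

theorem P_mul_P (z : Phase n) : P z * P z = -1 := by
  rw [P, fromBlocks_multiply, ← fromBlocks_one, fromBlocks_neg]
  simp

theorem P_inv (z : Phase n) : (P z)⁻¹ = -P z :=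
  inv_eq_right_inv (by rw [Matrix.mul_neg, P_mul_P, neg_neg])

theorem P_transpose (z : Phase n) : (P z)ᵀ = -P z := by
  simp [P, fromBlocks_transpose, fromBlocks_neg]

theorem P'_transpose (z : Phase n) : (P' z)ᵀ = -P' z := by
  have h1 : ∀ i j, P' z j i = -P' z i j := by
    rintro (i | i) (j | j)
    · simp only [P', fromBlocks_apply₁₁, of_apply]
      split_ifs <;> first | (exfalso; omega) | simp
    · simp [P', diagonal_apply, eq_comm]
      split_ifs with h <;> simp [h]
    · simp [P', diagonal_apply, eq_comm]
      split_ifs with h <;> simp [h]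
    · rw [P'_lower_right, P'_lower_right]; ring
  ext i j
  exact h1 i j

theorem bracket_antisymm {biv : Phase n → Matrix (Coord n) (Coord n) ℝ} {z : Phase n}
    (hb : (biv z)ᵀ = -biv z) (f g : Phase n → ℝ) :
    bracket biv f g z = -bracket biv g f z := by
  rw [bracket, bracket, dotProduct_mulVec, ← mulVec_transpose, hb, neg_mulVec, neg_dotProduct,
    dotProduct_comm]

theorem bracket_P'_eq {f g : Phase n → ℝ} {z : Phase n} {b : ℝ}
    (hg : P' z *ᵥ d g z = b • (P z *ᵥ d g z)) :
    bracket P' f g z = b * bracket P f g z := by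
  rw [bracket, hg, dotProduct_smul, smul_eq_mul, bracket]

/-- Eigenvectors of the recursion relation for distinct eigenvalues are in involution. -/
theorem bracket_eq_zero_of_ne {f g : Phase n → ℝ} {z : Phase n} {a b : ℝ}
    (hf : P' z *ᵥ d f z = a • (P z *ᵥ d f z)) (hg : P' z *ᵥ d g z = b • (P z *ᵥ d g z))
    (hab : a ≠ b) : bracket P f g z = 0 := by
  have h1 := bracket_P'_eq (f := f) hg
  have h2 := bracket_P'_eq (f := g) hf
  rw [bracket_antisymm (P'_transpose z), bracket_antisymm (P_transpose z), mul_neg,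
    neg_inj, h1] at h2
  have h3 : (a - b) * bracket P f g z = 0 := by rw [sub_mul, h2, sub_self]
  exact (mul_eq_zero.mp h3).resolve_left (sub_ne_zero.mpr hab)

theorem bracket_self {biv : Phase n → Matrix (Coord n) (Coord n) ℝ} {z : Phase n}
    (hb : (biv z)ᵀ = -biv z) (f : Phase n → ℝ) : bracket biv f f z = 0 :=
  self_eq_neg.mp (bracket_antisymm hb f f)

theorem lam_ne {i j : Fin n} (h : i ≠ j) (z : Phase n) : lam i z ≠ lam j z :=
  (lam_strictMono z).injective.ne h

theorem bracket_lam_lam (i j : Fin n) (z : Phase n) : bracket P (lam i) (lam j) z = 0 := by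
  by_cases h : i = j
  · rw [h, bracket_self (P_transpose z)]
  · exact bracket_eq_zero_of_ne (P'_d_lam i z) (P'_d_lam j z) (lam_ne h z)

theorem bracket_mu_mu (i j : Fin n) (z : Phase n) : bracket P (mu i) (mu j) z = 0 := by
  by_cases h : i = j
  · rw [h, bracket_self (P_transpose z)]
  · exact bracket_eq_zero_of_ne (P'_d_mu i z) (P'_d_mu j z) (lam_ne h z)

/-! ### Normalization of the brackets by translations -/

/-- The direction of the simultaneous translations of all particles. -/
def translation : Phase n := Sum.elim 1 0

theorem sum_d_lam (z : Phase n) : ∑ k, d (lam k) z = Sum.elim (0 : Fin n → ℝ) (1 : Fin n → ℝ) := by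
  have h1 : HasFDerivAt (fun y : Phase n => ∑ k, lam k y) (∑ k, fderiv ℝ (lam k) z) z :=
    HasFDerivAt.fun_sum fun k _ => (differentiableAt_lam k z).hasFDerivAt
  have h2 : HasFDerivAt (fun y : Phase n => ∑ k, p y k) _ z :=
    HasFDerivAt.fun_sum fun k _ => hasFDerivAt_p z k
  simp only [sum_lam] at h1
  have h3 := h1.unique h2
  ext a
  have h4 := DFunLike.congr_fun h3 (Pi.single a 1)
  simp only [_root_.sum_apply] at h4
  rw [Finset.sum_apply]
  refine h4.trans ?_
  rcases a with a | a <;> simp [Pi.single_apply]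

theorem lax_translate (z : Phase n) (c : ℝ) : lax (z + c • translation) = lax z := by
  ext i j
  simp [lax, q, p, translation]

theorem mu_translate (i : Fin n) (z : Phase n) (c : ℝ) :
    mu i (z + c • translation) = mu i z + c := by
  obtain ⟨l, hl⟩ := exists_last i
  have hlam : lam i (z + c • translation) = lam i z := by rw [lam, lam, A, A, lax_translate]
  have hne := eval_B_lam_ne_zero z i
  have hB : (B (z + c • translation)).eval (lam i z) =
      Real.exp c * (B z).eval (lam i z) := by
    rw [eval_B _ hl, eval_B _ hl, shifted, lax_translate, ← shifted,
      show q (z + c • translation) l = c + q z l by simp [q, translation, add_comm], Real.exp_add]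
    ring
  rw [mu, hlam, hB, Real.log_mul (Real.exp_ne_zero c) hne, Real.log_exp, mu, add_comm]

theorem fderiv_apply_eq_sum (f : Phase n → ℝ) (z v : Phase n) :
    fderiv ℝ f z v = d f z ⬝ᵥ v := by
  conv_lhs => rw [← Finset.univ_sum_single v]
  rw [map_sum]
  refine Finset.sum_congr rfl fun a _ => ?_
  rw [d, show Pi.single a (v a) = v a • (Pi.single a 1 : Phase n) by
    rw [← Pi.single_smul]; simp, map_smul, smul_eq_mul, mul_comm]

theorem d_mu_translation (i : Fin n) (z : Phase n) : d (mu i) z ⬝ᵥ translation = 1 := by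
  rw [← fderiv_apply_eq_sum]
  have h0 : HasFDerivAt (mu i) (fderiv ℝ (mu i) z) (z + (0 : ℝ) • translation) := by
    rw [zero_smul, add_zero]; exact (differentiableAt_mu i z).hasFDerivAt
  have h1 : HasDerivAt (fun c : ℝ => mu i (z + c • translation)) _ 0 :=
    h0.comp_hasDerivAt (0 : ℝ) (f := fun c : ℝ => z + c • translation)
      (((hasDerivAt_id (0 : ℝ)).smul_const translation).const_add z)
  simp only [mu_translate] at h1
  have h2 := h1.unique ((hasDerivAt_id (0 : ℝ)).const_add (mu i z))
  simpa using h2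

/-- Since `{μ_i, λ_k} = 0` for `k ≠ i`, the diagonal bracket equals `{μ_i, ∑ λ_k} = {μ_i, ∑ p_k}`,
the derivative of `μ_i` along translations. -/
theorem bracket_mu_lam (i j : Fin n) (z : Phase n) :
    bracket P (mu i) (lam j) z = if i = j then 1 else 0 := by
  have hne : ∀ k, i ≠ k → bracket P (mu i) (lam k) z = 0 := fun k h =>
    bracket_eq_zero_of_ne (P'_d_mu i z) (P'_d_lam k z) (lam_ne h z)
  by_cases h : i = j
  · subst h
    rw [if_pos rfl]
    have hsum : ∑ k, bracket P (mu i) (lam k) z = 1 := by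
      simp only [bracket]
      rw [← dotProduct_sum, ← mulVec_sum, sum_d_lam, ← d_mu_translation i z, P_mulVec]
      congr 1
      ext (a | a) <;> simp [translation]
    rwa [Finset.sum_eq_single i (fun k _ hk => hne k hk.symm) (by simp)] at hsum
  · rw [if_neg h, hne j h]

/-! ### The Jacobian -/

theorem isLocalDiffeomorph_of_hasFDerivAt {E : Type*} [NormedAddCommGroup E] [NormedSpace ℝ E]
    [CompleteSpace E] {f : E → E} {k : WithTop ℕ∞} (hk : k ≠ 0) (hf : ContDiff ℝ k f)
    (f' : E → E ≃L[ℝ] E) (hf' : ∀ x, HasFDerivAt f (f' x : E →L[ℝ] E) x) :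
    IsLocalDiffeomorph (modelWithCornersSelf ℝ E) (modelWithCornersSelf ℝ E) k f := by
  intro x
  let e := hf.contDiffAt.toOpenPartialHomeomorph f (hf' x) hk
  refine ⟨{ toPartialEquiv := e.toPartialEquiv
            open_source := e.open_source
            open_target := e.open_target
            contMDiffOn_toFun := (contMDiff_iff_contDiff.mpr hf).contMDiffOn
            contMDiffOn_invFun := contMDiffOn_iff_contDiffOn.mpr fun y hy =>
              (e.contDiffAt_symm hy (hf' _) hf.contDiffAt).contDiffWithinAt },
    hf.contDiffAt.mem_toOpenPartialHomeomorph_source (hf' x) hk, fun y _ => rfl⟩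

theorem jacobian_mul_P_mul_transpose (z : Phase n) :
    jacobian mu lam z * P z * (jacobian mu lam z)ᵀ = P z := by
  have h : ∀ (f g : Phase n → ℝ), ∑ c, (∑ b, d f z b * P z b c) * d g z c = bracket P f g z := by
    intro f g
    rw [bracket, dotProduct_mulVec]
    rfl
  ext (i | i) (j | j)
  · refine (h (mu i) (mu j)).trans ?_
    simp [bracket_mu_mu, P]
  · refine (h (mu i) (lam j)).trans ?_
    simp [bracket_mu_lam, P, one_apply]
  · refine (h (lam i) (mu j)).trans ?_
    rw [bracket_antisymm (P_transpose z)]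
    simp [bracket_mu_lam, P, one_apply, eq_comm]
  · refine (h (lam i) (lam j)).trans ?_
    simp [bracket_lam_lam, P]

theorem isUnit_det_jacobian (z : Phase n) : IsUnit (jacobian mu lam z).det := by
  have h : jacobian mu lam z * (P z * (jacobian mu lam z)ᵀ * -P z) = 1 := by
    rw [← Matrix.mul_assoc, ← Matrix.mul_assoc, jacobian_mul_P_mul_transpose, Matrix.mul_neg,
      P_mul_P, neg_neg]
  exact (isUnit_iff_isUnit_det _).mp (IsUnit.of_mul_eq_one _ h)

/-- The dual form of the symplectic condition, obtained by turning a right inverse of the Jacobian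
into a left one; entrywise it is `ω = ∑ dλ_i ∧ dμ_i`. -/
theorem transpose_mul_P_mul_jacobian (z : Phase n) :
    (jacobian mu lam z)ᵀ * -P z * jacobian mu lam z = -P z := by
  have h : jacobian mu lam z * (P z * (jacobian mu lam z)ᵀ * -P z) = 1 := by
    rw [← Matrix.mul_assoc, ← Matrix.mul_assoc, jacobian_mul_P_mul_transpose, Matrix.mul_neg,
      P_mul_P, neg_neg]
  have h2 := mul_eq_one_comm.mp h
  calc (jacobian mu lam z)ᵀ * -P z * jacobian mu lam z
      = -P z * (P z * (jacobian mu lam z)ᵀ * -P z * jacobian mu lam z) := by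
        simp only [← Matrix.mul_assoc]
        rw [Matrix.neg_mul, P_mul_P, neg_neg, Matrix.one_mul]
    _ = -P z := by rw [h2, Matrix.mul_one]

theorem contDiff_coordMap {k : ℕ∞} (hk : k ≠ 0) :
    ContDiff ℝ k (coordMap (n := n) mu lam) := by
  refine contDiff_pi.mpr ?_
  rintro (i | i)
  · exact contDiff_iff_contDiffAt.mpr fun z => contDiffAt_mu i z hk
  · exact contDiff_iff_contDiffAt.mpr fun z => contDiffAt_lam i z hk

theorem isLocalDiffeomorph_coordMap :
    IsLocalDiffeomorph (modelWithCornersSelf ℝ (Phase n)) (modelWithCornersSelf ℝ (Phase n))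
      ((⊤ : ℕ∞) : WithTop ℕ∞) (coordMap (n := n) mu lam) := by
  refine isLocalDiffeomorph_of_hasFDerivAt (by simp) (contDiff_coordMap (by simp))
    (fun z => (Matrix.toLinearEquiv' (jacobian mu lam z)
      ((jacobian mu lam z).invertibleOfIsUnitDet
        (isUnit_det_jacobian z))).toContinuousLinearEquiv) fun z => ?_
  refine hasFDerivAt_pi'.mpr ?_
  rintro (i | i)
  · refine (differentiableAt_mu i z).hasFDerivAt.congr_fderiv ?_
    ext1 v
    exact fderiv_apply_eq_sum _ _ _
  · refine (differentiableAt_lam i z).hasFDerivAt.congr_fderiv ?_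
    ext1 v
    exact fderiv_apply_eq_sum _ _ _

/-! ### The recursion operator in Moser coordinates -/

theorem Nstar_mulVec_of_P' {z : Phase n} {ξ : Coord n → ℝ} {a : ℝ}
    (h : P' z *ᵥ ξ = a • (P z *ᵥ ξ)) : Nstar z *ᵥ ξ = a • ξ := by
  rw [Nstar, ← mulVec_mulVec, h, mulVec_smul, mulVec_mulVec, P_inv, Matrix.neg_mul, P_mul_P,
    neg_neg, one_mulVec]

theorem N_transpose (z : Phase n) : (N z)ᵀ = Nstar z := by
  rw [N, Nstar, transpose_mul, P_inv, transpose_neg, P_transpose, P'_transpose]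
  simp

/-- The rows of the Jacobian are eigenvectors of `N^*`, the transpose of `N`, hence left
eigenvectors of `N`. -/
theorem jacobian_mul_N (z : Phase n) : jacobian mu lam z * N z =
    diagonal (Sum.elim (fun i => lam i z) fun i => lam i z) * jacobian mu lam z := by
  have h : ∀ (f : Phase n → ℝ) (a : ℝ), P' z *ᵥ d f z = a • (P z *ᵥ d f z) →
      ∀ b, ∑ c, d f z c * N z c b = a * d f z b := by
    intro f a hf b
    have h1 := congrFun (Nstar_mulVec_of_P' hf) b
    rw [← N_transpose, mulVec_transpose] at h1
    exact h1
  ext (i | i) b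
  · rw [diagonal_mul]
    exact h (mu i) _ (P'_d_mu i z) b
  · rw [diagonal_mul]
    exact h (lam i) _ (P'_d_lam i z) b

theorem jacobian_conj_N (z : Phase n) :
    jacobian mu lam z * N z * (jacobian mu lam z)⁻¹ =
      diagonal (Sum.elim (fun i => lam i z) fun i => lam i z) := by
  rw [jacobian_mul_N, mul_nonsing_inv_cancel_right _ _ (isUnit_det_jacobian z)]

theorem isDarbouxNijenhuis_mu_lam : IsDarbouxNijenhuis (n := n) mu lam lam where
  coordinates := isLocalDiffeomorph_coordMap
  canonical z := by
    rw [P_inv, ← transpose_mul_P_mul_jacobian]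
    ext a b
    rw [mul_apply]
    simp only [mul_apply, Fintype.sum_sum_type]
    rw [← Finset.sum_add_distrib, Matrix.sum_apply]
    refine Finset.sum_congr rfl fun i _ => ?_
    simp [P, jacobian, vecMulVec_apply, one_apply]
    ring
  diagonalizes := jacobian_conj_N

/-- `N` is conjugate to a diagonal matrix in which each `λ_i` occurs twice. -/
theorem isMinimalCharpoly_A (z : Phase n) : IsMinimalCharpoly (N z) (A z) := by
  refine ⟨charpoly_monic _, ?_⟩
  have h : (jacobian mu lam z * N z * (jacobian mu lam z)⁻¹).charpoly = (N z).charpoly := by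
    rw [charpoly_mul_comm, ← Matrix.mul_assoc, nonsing_inv_mul _ (isUnit_det_jacobian z),
      Matrix.one_mul]
  rw [← h, jacobian_conj_N, charpoly_diagonal, Fintype.prod_sum_type]
  simp only [Sum.elim_inl, Sum.elim_inr]
  rw [← A_eq_prod, sq]

end Toda

end

theorem mainTheorem1 (n : ℕ) (hn : 1 ≤ n) :
    -- `λ₁ < … < λₙ` are the roots of `A`, and `A` is the minimal characteristic polynomial of `N`
    (∀ z : Toda.Phase n,
      StrictMono (fun i => Toda.lam i z) ∧
      Toda.A z = ∏ i, (Polynomial.X - Polynomial.C (Toda.lam i z)) ∧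
      Toda.IsMinimalCharpoly (Toda.N z) (Toda.A z)) ∧
    -- `B` is the numerator of the Weyl function, and it does not vanish at the roots of `A`
    (∀ z : Toda.Phase n,
      (∀ t : ℝ, (Toda.A z).eval t ≠ 0 →
        Toda.weyl z t = (Toda.B z).eval t / (Toda.A z).eval t) ∧
      (Toda.B z).natDegree = n - 1 ∧
      (Toda.B z).leadingCoeff = -Real.exp (Toda.q z ⟨n - 1, by omega⟩) ∧
      ∀ i, (Toda.B z).eval (Toda.lam i z) ≠ 0) ∧
    -- `(μ, λ)` are the special Darboux–Nijenhuis coordinates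
    Toda.IsDarbouxNijenhuis (n := n) Toda.mu Toda.lam Toda.lam ∧
    -- brackets
    (∀ (z : Toda.Phase n) (i j : Fin n),
      Toda.bracket Toda.P (Toda.mu i) (Toda.lam j) z = (if i = j then 1 else 0) ∧
      Toda.bracket Toda.P (Toda.lam i) (Toda.lam j) z = 0 ∧
      Toda.bracket Toda.P (Toda.mu i) (Toda.mu j) z = 0 ∧
      Toda.bracket Toda.P' (Toda.mu i) (Toda.lam j) z = (if i = j then Toda.lam i z else 0) ∧
      Toda.bracket Toda.P' (Toda.lam i) (Toda.lam j) z = 0 ∧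
      Toda.bracket Toda.P' (Toda.mu i) (Toda.mu j) z = 0) ∧
    -- the differentials of `λ_i` and `μ_i` are eigenvectors of `N^*`
    (∀ (z : Toda.Phase n) (i : Fin n),
      (Toda.Nstar z).mulVec (Toda.d (Toda.lam i) z) = Toda.lam i z • Toda.d (Toda.lam i) z ∧
      (Toda.Nstar z).mulVec (Toda.d (Toda.mu i) z) = Toda.lam i z • Toda.d (Toda.mu i) z) := by
  obtain ⟨l, hl⟩ := Toda.exists_last (⟨n - 1, by omega⟩ : Fin n)
  have hlast : (⟨n - 1, by omega⟩ : Fin n) = l := Fin.ext (by simp only; omega)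
  refine ⟨fun z => ⟨Toda.lam_strictMono z, Toda.A_eq_prod z, Toda.isMinimalCharpoly_A z⟩,
    fun z => ⟨fun t ht => Toda.weyl_eq z hl t ht, Toda.natDegree_B z hl, ?_,
      Toda.eval_B_lam_ne_zero z⟩,
    Toda.isDarbouxNijenhuis_mu_lam, fun z i j => ⟨Toda.bracket_mu_lam i j z,
      Toda.bracket_lam_lam i j z, Toda.bracket_mu_mu i j z, ?_, ?_, ?_⟩,
    fun z i => ⟨Toda.Nstar_mulVec_of_P' (Toda.P'_d_lam i z),
      Toda.Nstar_mulVec_of_P' (Toda.P'_d_mu i z)⟩⟩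
  · rw [hlast, Toda.leadingCoeff_B z hl]
  · rw [Toda.bracket_P'_eq (Toda.P'_d_lam j z), Toda.bracket_mu_lam]
    split_ifs with h
    · rw [h, mul_one]
    · rw [mul_zero]
  · rw [Toda.bracket_P'_eq (Toda.P'_d_lam j z), Toda.bracket_lam_lam, mul_zero]
  · rw [Toda.bracket_P'_eq (Toda.P'_d_mu j z), Toda.bracket_mu_mu, mul_zero]
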